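/- Let $X_1,\dots,X_d$ be $\sigma$-finite measure spaces and let all functions be complex valued. For $\varphi_k\in L^2(X_k)$ write $(\varphi_1\otimes\cdots\otimes\varphi_d)(x_1,\dots,x_d)=\varphi_1(x_1)\cdots\varphi_d(x_d)$. The rank of $f\in L^2(X_1\times\cdots\times X_d)$ is the least $r$ such that $f$ is (a.e.) a sum of $r$ such products; it is $0$ for $f=0$, and $\infty$ if there is no such $r$. For a finite family $\Phi=(\varphi_1,\dots,\varphi_r)$ of unit vectors in a Hilbert space let $\mu(\Phi)=\max_{p\neq q}|\langle\varphi_p,\varphi_q\rangle|$ (with value $0$ if there is no pair $p\ne q$) and $\omega(\Phi)=(1-\mu(\Phi))/\mu(\Phi)\in[0,\infty]$, and let $\operatorname{krank}\Phi$ be the largest $k\le r$ such that any $k$ members of the family (with distinct indices) are linearly independent. **Theorem (uniqueness and minimality via coherence).** Suppose that $f\in L^2(X_1\times\cdots\times X_d)$ has a decomposition $$f=\sum_{p=1}^r\lambda_p\,\varphi_{1p}\otimes\cdots\otimes\varphi_{dp}$$ with nonzero $\lambda_p\in\mathbb C$ and $\varphi_{kp}\in L^2(X_k)$ of unit norm.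 Put $\Phi_k=(\varphi_{k1},\dots,\varphi_{kr})$, $\mu_k=\mu(\Phi_k)$, $\omega_k=\omega(\Phi_k)$, and suppose that $\operatorname{krank}\Phi_k<\dim\operatorname{span}\Phi_k$ for all $k=1,\dots,d$. Then the two conditions $$\sum_{k=1}^d\omega_k\ge 2r-1\qquad\text{and}\qquad\sum_{k=1}^d\frac1{\mu_k}\ge 2r+d-1$$ are equivalent. If they hold, then $r=\operatorname{rank}(f)$ and the decomposition is essentially unique, in the following sense. 1. If $f=\sum_{p=1}^r\kappa_p\,\psi_{1p}\otimes\cdots\otimes\psi_{dp}$ with $\kappa_p\in\mathbb C$ and all $\psi_{kp}\in L^2(X_k)$ of unit norm, then there are a permutation $\pi$ of $\{1,\dots,r\}$ and complex numbers $c_{kp}$ of modulus $1$ such that $\varphi_{kp}=c_{kp}\psi_{k\pi(p)}$ for all $k,p$ and $\kappa_{\pi(p)}=\lambda_p\prod_{k=1}^d c_{kp}$ for all $p$. 2. If moreover the coefficients are normalized so that $\lambda_1\ge\cdots\ge\lambda_r>0$ are real, and likewise $\kappa_1\ge\cdots\ge\kappa_r>0$, then $\lambda_p=\kappa_p$ for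 all $p$, and there are a permutation $\pi$ of $\{1,\dots,r\}$ with $\lambda_{\pi(p)}=\lambda_p$ for all $p$ and real numbers $\theta_{kp}$ with $\sum_{k=1}^d\theta_{kp}\equiv0\pmod{2\pi}$ such that $\varphi_{kp}=e^{i\theta_{kp}}\psi_{k\pi(p)}$ for all $k,p$. -/

import Mathlib

open MeasureTheory
open scoped ENNReal

noncomputable section

namespace MultilinearDecomposition

section Families

variable {ι H : Type*} [Fintype ι] [NormedAddCommGroup H] [InnerProductSpace ℂ H]

/-- Coherence of a finite family of (unit) vectors: the largest `|⟪φ p, φ q⟫|` over pairs of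
distinct indices `p ≠ q` (and `0` if there is no such pair). -/
def coherence (φ : ι → H) : ℝ≥0∞ :=
  ⨆ (p : ι) (q : ι) (_ : p ≠ q), ‖inner ℂ (φ p) (φ q)‖ₑ

/-- Relative incoherence `ω = (1 - μ) / μ`, with values in `[0, ∞]`; it is `∞` when `μ = 0`. -/
def relIncoherence (φ : ι → H) : ℝ≥0∞ :=
  (1 - coherence φ) / coherence φ

/-- Kruskal rank of a finite family: the largest `k` not exceeding the number of indices such that
every subfamily indexed by `k` distinct indices is linearly independent.  The set below contains
`0` and is bounded, so the supremum is a maximum. -/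
def krank (φ : ι → H) : ℕ :=
  sSup {k : ℕ | k ≤ Fintype.card ι ∧
    ∀ S : Finset ι, S.card = k → LinearIndependent ℂ (fun i : S => φ i)}

/-- The dimension of the linear span of the family. -/
def dimSpan (φ : ι → H) : ℕ :=
  Module.finrank ℂ (Submodule.span ℂ (Set.range φ))

end Families

section Functions

variable {d : ℕ} {X : Fin d → Type*} [∀ k, MeasurableSpace (X k)] {μ : ∀ k, Measure (X k)}

/-- The function `φ₁ ⊗ ⋯ ⊗ φ_d : (x₁, …, x_d) ↦ φ₁(x₁) ⋯ φ_d(x_d)`. -/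
def tensorFun (φ : ∀ k, Lp ℂ 2 (μ k)) (x : ∀ k, X k) : ℂ :=
  ∏ k, φ k (x k)

variable [∀ k, SigmaFinite (μ k)]

/-- The rank of `f ∈ L²(X₁ × ⋯ × X_d)`: the least `r` such that `f` is almost everywhere a sum of
`r` tensor products of functions in `L²(X_k)`; it is `0` for `f = 0`, and `⊤` if there is no
such `r`. -/
def rank (f : Lp ℂ 2 (Measure.pi μ)) : ℕ∞ :=
  ⨅ (r : ℕ) (_ : ∃ φ : ∀ k, Fin r → Lp ℂ 2 (μ k),
    f =ᵐ[Measure.pi μ] fun x => ∑ p, tensorFun (fun k => φ k p) x), (r : ℕ∞)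

/-- `f = ∑ₚ lam p • φ₁ₚ ⊗ ⋯ ⊗ φ_dₚ` in `L²(X₁ × ⋯ × X_d)`, all factors being of unit norm. -/
structure IsUnitDecomposition {r : ℕ} (f : Lp ℂ 2 (Measure.pi μ)) (lam : Fin r → ℂ)
    (φ : ∀ k, Fin r → Lp ℂ 2 (μ k)) : Prop where
  norm_eq_one : ∀ k p, ‖φ k p‖ = 1
  ae_eq : f =ᵐ[Measure.pi μ] fun x => ∑ p, lam p * tensorFun (fun k => φ k p) x

/-- A decomposition with unit factors whose coefficients are real, positive and in
descending order. -/
structure IsOrderedDecomposition {r : ℕ} (f : Lp ℂ 2 (Measure.pi μ)) (σ : Fin r → ℝ)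
    (φ : ∀ k, Fin r → Lp ℂ 2 (μ k)) : Prop where
  antitone : Antitone σ
  pos : ∀ p, 0 < σ p
  decomposition : IsUnitDecomposition f (fun p => (σ p : ℂ)) φ

/-- Essential uniqueness of the ordered decomposition `(σ, φ)` of `f`: any other ordered
decomposition with `r` terms has the same coefficients, and, up to relabelling terms with equal
coefficients, its factors are the same up to phases `exp (i θ k p)` with
`∑ₖ θ k p ≡ 0 mod 2π`. -/
def EssentiallyUnique {r : ℕ} (f : Lp ℂ 2 (Measure.pi μ)) (σ : Fin r → ℝ)
    (φ : ∀ k, Fin r → Lp ℂ 2 (μ k)) : Prop :=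
  ∀ (τ : Fin r → ℝ) (ψ : ∀ k, Fin r → Lp ℂ 2 (μ k)), IsOrderedDecomposition f τ ψ →
    (∀ p, σ p = τ p) ∧
    ∃ e : Equiv.Perm (Fin r), (∀ p, σ (e p) = σ p) ∧
      ∃ θ : Fin d → Fin r → ℝ,
        (∀ k p, φ k p = Complex.exp (Complex.I * (θ k p : ℂ)) • ψ k (e p)) ∧
        ∀ p, ∃ m : ℤ, ∑ k, θ k p = 2 * Real.pi * m

/-- Essential uniqueness for arbitrary complex coefficients, which need not be ordered: any other
decomposition with `r` terms and unit factors is obtained by permuting the terms and multiplying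
the factors by unimodular constants, the coefficients changing by the product of these
constants. -/
def UniqueUpToOrderAndPhase {r : ℕ} (f : Lp ℂ 2 (Measure.pi μ)) (lam : Fin r → ℂ)
    (φ : ∀ k, Fin r → Lp ℂ 2 (μ k)) : Prop :=
  ∀ (κ : Fin r → ℂ) (ψ : ∀ k, Fin r → Lp ℂ 2 (μ k)), IsUnitDecomposition f κ ψ →
    ∃ (e : Equiv.Perm (Fin r)) (c : Fin d → Fin r → ℂ),
      (∀ k p, ‖c k p‖ = 1) ∧
      (∀ k p, φ k p = c k p • ψ k (e p)) ∧
      ∀ p, κ (e p) = lam p * ∏ k, c k p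

end Functions

end MultilinearDecomposition

end

/-! If $n\mu<1$, the Gram matrix of any $n+1$ members of a family of unit vectors is strictly
diagonally dominant, so they are independent. With $n=\operatorname{krank}\Phi_k$, which is below
the number of vectors, this would contradict maximality; hence
$1/\mu_k\le\operatorname{krank}\Phi_k$, and the coherence condition implies Kruskal's condition
$\sum_k\operatorname{krank}\Phi_k\ge 2r+d-1$.

Kruskal's theorem (`kruskal`) rests on a splitting bound, `Nonsplit.sum_finrank_le`: product tensors
that do not divide into two parts with independent spans span at least
$\sum_k\dim\operatorname{span}-(d-1)$ dimensions. The difference of two decompositions of $f$ is a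
linear relation. Its minimal vanishing subrelations are nonsplit, and by the bound each either has
more terms from the second decomposition than from the first or matches one term of each. Counting
gives minimality and uniqueness. Tensors are handled through their values on tuples of functionals;
integration against products transfers $L^2$ identities to that model. -/

namespace MultilinearDecomposition

open Module Submodule

/-! ### Dimension bounds for nonsplit families of product tensors -/

section LinearAlgebra

variable {K : Type*} [Field K]

/-- If `∑ b, u b ⊗ y b = 0`, then the ranks of `u` and `y` add up to at most the number of terms. -/
theorem finrank_span_add_finrank_span_le_card {U Y C : Type*} [AddCommGroup U] [Module K U]
    [AddCommGroup Y] [Module K Y] [Fintype C] (u : C → U) (y : C → Y)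
    (h : ∀ f : Dual K U, ∑ b, f (u b) • y b = 0) :
    finrank K (span K (Set.range u)) + finrank K (span K (Set.range y)) ≤ Fintype.card C := by
  classical
  let Lu := Fintype.linearCombination K u
  let Ly := Fintype.linearCombination K y
  let E : (C → K) ≃ₗ[K] Dual K (C → K) := dotProductEquiv K C
  -- The row space of `u`, of dimension the rank of `u`, consists of linear relations among the `y
  -- b`; these form a space of dimension `card C` minus the rank of `y`.
  have hle : (LinearMap.range Lu.dualMap).map E.symm.toLinearMap ≤ LinearMap.ker Ly := by
    rintro _ ⟨_, ⟨f, rfl⟩, rfl⟩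
    have hE : ∀ b, E.symm (Lu.dualMap f) b = f (u b) := by
      intro b
      have h1 : E (E.symm (Lu.dualMap f)) (Pi.single b 1) = f (u b) := by
        rw [LinearEquiv.apply_symm_apply]
        simp [Lu]
      simpa [E] using h1
    simp only [LinearEquiv.coe_coe, LinearMap.mem_ker, Ly, Fintype.linearCombination_apply, hE, h f]
  have h1 := Submodule.finrank_mono hle
  rw [LinearEquiv.finrank_map_eq, LinearMap.finrank_range_dualMap_eq_finrank_range,
    Fintype.range_linearCombination] at h1
  have h2 := LinearMap.finrank_range_add_finrank_ker Ly
  rw [Fintype.range_linearCombination, Module.finrank_fintype_fun_eq_card] at h2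
  omega

theorem finrank_sup_le_finrank_add_finrank_map_mkQ {V : Type*} [AddCommGroup V] [Module K V]
    (W A : Submodule K V) [FiniteDimensional K W] [FiniteDimensional K A] :
    finrank K (W ⊔ A : Submodule K V) ≤ finrank K W + finrank K (A.map W.mkQ) := by
  have h := LinearMap.finrank_range_add_finrank_ker (W.mkQ.domRestrict (W ⊔ A))
  have hr : LinearMap.range (W.mkQ.domRestrict (W ⊔ A)) = A.map W.mkQ := by
    rw [LinearMap.range_domRestrict, Submodule.map_sup, Submodule.mkQ_map_self, bot_sup_eq]
  have hk : finrank K (LinearMap.ker (W.mkQ.domRestrict (W ⊔ A))) = finrank K W := by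
    rw [LinearMap.ker_domRestrict, Submodule.ker_mkQ]
    exact (Submodule.comapSubtypeEquivOfLe le_sup_left).finrank_eq
  rw [hr, hk] at h
  omega


/-- The family cannot be divided into two nonempty subfamilies with independent spans. -/
def Nonsplit (K : Type*) [Field K] {ι M : Type*} [AddCommGroup M] [Module K M] (z : ι → M) : Prop :=
  ∀ S : Finset ι, S.Nonempty → (∃ a, a ∉ S) →
    ∃ t, t ≠ 0 ∧ t ∈ span K (z '' S) ∧ t ∈ span K (z '' (S : Set ι)ᶜ)

section TwoFactors

variable {ι V Y M : Type*} [Fintype ι] [AddCommGroup V] [Module K V] [AddCommGroup Y] [Module K Y]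
  [AddCommGroup M] [Module K M]

theorem finiteDimensional_span_image (x : ι → V) (S : Set ι) :
    FiniteDimensional K (span K (x '' S)) :=
  FiniteDimensional.span_of_finite K (S.toFinite.image x)

/-- Here `z a` stands for $x_a\otimes y_a$ and `ev f` for contraction of the first factor with `f`.
Adjoining a minimal `C` whose `z`-span meets that of `T` raises the `z`-dimension by at least
$|C|-1$, and the `x`- and `y`-dimensions together by at most $|C|-1$. -/
theorem exists_finset_enlarge [DecidableEq ι] {x : ι → V} {y : ι → Y} {z : ι → M}
    (ev : Dual K V → M →ₗ[K] Y) (hev : ∀ f a, ev f (z a) = f (x a) • y a)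
    (hinj : ∀ t, (∀ f, ev f t = 0) → t = 0) (hns : Nonsplit K z) (T : Finset ι)
    (hT : T.Nonempty) (hT' : ∃ a, a ∉ T)
    (hle : finrank K (span K (x '' T)) + finrank K (span K (y '' T)) ≤
      finrank K (span K (z '' T)) + 1) :
    ∃ T' : Finset ι, T ⊂ T' ∧ finrank K (span K (x '' T')) + finrank K (span K (y '' T')) ≤
      finrank K (span K (z '' T')) + 1 := by
  have fx : ∀ S : Set ι, FiniteDimensional K (span K (x '' S)) := finiteDimensional_span_image x
  have fy : ∀ S : Set ι, FiniteDimensional K (span K (y '' S)) := finiteDimensional_span_image y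
  have fz : ∀ S : Set ι, FiniteDimensional K (span K (z '' S)) := finiteDimensional_span_image z
  obtain ⟨C, ⟨hCT, t, ht0, htT, htC⟩, hmin⟩ := (wellFounded_lt (α := Finset ι)).has_min
    {C : Finset ι | Disjoint T C ∧
      ∃ t, t ≠ 0 ∧ t ∈ span K (z '' T) ∧ t ∈ span K (z '' (C : Set ι))}
    ⟨Tᶜ, disjoint_compl_right, by simpa using hns T hT hT'⟩
  have hminb : ∀ b ∈ C, ∀ s ∈ span K (z '' T), s ∈ span K (z '' (C.erase b : Finset ι)) → s = 0 := by
    intro b hb s hsT hsC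
    by_contra hs
    exact hmin (C.erase b) ⟨hCT.mono_right (Finset.erase_subset _ _), s, hs, hsT, hsC⟩
      (Finset.erase_ssubset hb)
  have hCne : C.Nonempty := by
    rw [Finset.nonempty_iff_ne_empty]
    rintro rfl
    simp at htC
    exact ht0 htC
  obtain ⟨b₀, hb₀⟩ := hCne
  obtain ⟨c, hc⟩ := (Submodule.mem_span_image_finset_iff_exists_fun K).1 htC
  -- A zero coefficient would let `b` be removed from `C`, against minimality.
  have hc0 : ∀ b, c b ≠ 0 := by
    intro b hb
    refine ht0 (hminb b b.2 t htT ?_)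
    rw [← hc]
    refine Submodule.sum_mem _ fun i _ => ?_
    by_cases hi : i = b
    · simp [hi, hb]
    · refine Submodule.smul_mem _ _ (Submodule.subset_span ⟨i, ?_, rfl⟩)
      simp only [Finset.mem_coe, Finset.mem_erase]
      exact ⟨fun h => hi (Subtype.ext h), i.2⟩
  have hind : LinearIndepOn K z (C : Set ι) := by
    rw [linearIndepOn_iff_notMem_span]
    intro b hb hmem
    rw [← Finset.coe_erase] at hmem
    refine ht0 (hminb b hb t htT ?_)
    refine (Submodule.span_le.2 ?_) htC
    rintro _ ⟨i, hi, rfl⟩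
    by_cases hib : i = b
    · exact hib ▸ hmem
    · exact Submodule.subset_span ⟨i, by simpa [hib] using hi, rfl⟩
  have hcardC : 1 ≤ C.card := Finset.card_pos.2 ⟨b₀, hb₀⟩
  -- growth of the span of `z`
  have hz : finrank K (span K (z '' T)) + (C.card - 1) ≤
      finrank K (span K (z '' (T ∪ C : Finset ι))) := by
    have h1 : LinearIndepOn K z (C.erase b₀ : Finset ι) := hind.mono (by simp)
    have h2 : finrank K (span K (z '' (C.erase b₀ : Finset ι))) = C.card - 1 := by
      rw [Set.image_eq_range, finrank_span_eq_card h1]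
      simp only [Finset.coe_sort_coe, Fintype.card_coe, Finset.card_erase_of_mem hb₀]
    have h3 := Submodule.finrank_sup_add_finrank_inf_eq (span K (z '' (T : Set ι)))
      (span K (z '' (C.erase b₀ : Finset ι)))
    have h4 : span K (z '' (T : Set ι)) ⊓ span K (z '' (C.erase b₀ : Finset ι)) = ⊥ := by
      rw [eq_bot_iff]
      rintro s ⟨hs1, hs2⟩
      exact hminb b₀ hb₀ s hs1 hs2
    rw [h4, finrank_bot, h2] at h3
    have h5 : span K (z '' (T : Set ι)) ⊔ span K (z '' (C.erase b₀ : Finset ι)) ≤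
        span K (z '' (T ∪ C : Finset ι)) := by
      refine sup_le (Submodule.span_mono (Set.image_mono ?_))
        (Submodule.span_mono (Set.image_mono ?_))
      · simp
      · intro i hi
        simp at hi
        simp [hi.1]
    have h6 := Submodule.finrank_mono h5
    omega
  have hx : finrank K (span K (x '' (T ∪ C : Finset ι))) + finrank K (span K (y '' C)) ≤
      finrank K (span K (x '' T)) + C.card := by
    -- Modulo `W` the tensor `t` vanishes because it lies in the span over `T`. Expanded over `C`,
    -- this is a relation $\sum_b c_b\bar x_b\otimes y_b=0$, to which the rank bound applies.
    let W := span K (x '' (T : Set ι))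
    have h1 := finrank_span_add_finrank_span_le_card (K := K) (fun b : C => c b • W.mkQ (x b))
      (fun b : C => y b) (by
        intro f
        have h1 : ev (f ∘ₗ W.mkQ) t = ∑ b : C, f (c b • W.mkQ (x b)) • y b := by
          rw [← hc, map_sum]
          refine Finset.sum_congr rfl fun b _ => ?_
          rw [map_smul, hev, smul_smul, map_smul]
          rfl
        have h2 : span K (z '' T) ≤ LinearMap.ker (ev (f ∘ₗ W.mkQ)) := by
          rw [Submodule.span_le]
          rintro _ ⟨a, ha, rfl⟩
          have : W.mkQ (x a) = 0 := by
            rw [Submodule.mkQ_apply, Submodule.Quotient.mk_eq_zero]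
            exact Submodule.subset_span ⟨a, ha, rfl⟩
          simp [hev, this]
        rw [← h1]
        exact h2 htT)
    have h2 := finrank_sup_le_finrank_add_finrank_map_mkQ W (span K (x '' (C : Set ι)))
    have h3 : span K (Set.range fun b : C => c b • W.mkQ (x b)) =
        (span K (x '' (C : Set ι))).map W.mkQ := by
      rw [Submodule.map_span]
      apply le_antisymm <;> rw [Submodule.span_le]
      · rintro _ ⟨b, rfl⟩
        exact Submodule.smul_mem _ _ (Submodule.subset_span ⟨x b, ⟨b, b.2, rfl⟩, rfl⟩)
      · rintro _ ⟨_, ⟨b, hb, rfl⟩, rfl⟩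
        have := Submodule.smul_mem (span K (Set.range fun b : C => c b • W.mkQ (x b)))
          (c ⟨b, hb⟩)⁻¹ (Submodule.subset_span ⟨⟨b, hb⟩, rfl⟩)
        simpa [smul_smul, inv_mul_cancel₀ (hc0 ⟨b, hb⟩)] using this
    have h4 : span K (x '' (T ∪ C : Finset ι)) = W ⊔ span K (x '' (C : Set ι)) := by
      rw [Finset.coe_union, Set.image_union, Submodule.span_union]
    have h5 : span K (Set.range fun b : C => y b) = span K (y '' C) := by
      rw [Set.image_eq_range]; rfl
    rw [h3, h5, Fintype.card_coe] at h1
    rw [h4]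
    change _ ≤ finrank K W + _
    omega
  have hy : finrank K (span K (y '' (T ∪ C : Finset ι))) + 1 ≤
      finrank K (span K (y '' T)) + finrank K (span K (y '' C)) := by
    -- A nonzero contraction of `t` lies in both `y`-spans, which saves one dimension in their sum.
    have h1 : ∃ f, ev f t ≠ 0 := by
      by_contra! h
      exact ht0 (hinj t h)
    obtain ⟨f, hf⟩ := h1
    have h2 : ∀ S : Set ι, span K (z '' S) ≤ (span K (y '' S)).comap (ev f) := by
      intro S
      rw [Submodule.span_le]
      rintro _ ⟨a, ha, rfl⟩
      simp only [SetLike.mem_coe, Submodule.mem_comap, hev]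
      exact Submodule.smul_mem _ _ (Submodule.subset_span ⟨a, ha, rfl⟩)
    have h3 : 0 < finrank K (span K (y '' (T : Set ι)) ⊓ span K (y '' (C : Set ι)) :
        Submodule K Y) := by
      rw [Module.finrank_pos_iff_exists_ne_zero]
      exact ⟨⟨ev f t, h2 _ htT, h2 _ htC⟩, fun h => hf (congrArg Subtype.val h)⟩
    have h4 := Submodule.finrank_sup_add_finrank_inf_eq (span K (y '' (T : Set ι)))
      (span K (y '' (C : Set ι)))
    rw [Finset.coe_union, Set.image_union, Submodule.span_union]
    omega
  refine ⟨T ∪ C, ?_, by omega⟩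
  refine Finset.ssubset_iff_subset_ne.2 ⟨Finset.subset_union_left, fun h => ?_⟩
  exact Finset.disjoint_left.1 hCT (h ▸ Finset.mem_union_right T hb₀) hb₀

/-- A singleton satisfies the inequality, and a maximal subfamily satisfying it must be everything,
since a proper one can be enlarged. -/
theorem Nonsplit.finrank_add_finrank_le [Nonempty ι] {x : ι → V} {y : ι → Y} {z : ι → M}
    (hns : Nonsplit K z) (ev : Dual K V → M →ₗ[K] Y) (hev : ∀ f a, ev f (z a) = f (x a) • y a)
    (hinj : ∀ t, (∀ f, ev f t = 0) → t = 0) (hz : ∀ a, z a ≠ 0) :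
    finrank K (span K (Set.range x)) + finrank K (span K (Set.range y)) ≤
      finrank K (span K (Set.range z)) + 1 := by
  classical
  obtain ⟨a₀⟩ := ‹Nonempty ι›
  have hsingle : finrank K (span K (x '' ({a₀} : Finset ι))) +
      finrank K (span K (y '' ({a₀} : Finset ι))) ≤
      finrank K (span K (z '' ({a₀} : Finset ι))) + 1 := by
    have h1 := finrank_span_le_card (R := K) ({x a₀} : Set V)
    have h2 := finrank_span_le_card (R := K) ({y a₀} : Set Y)
    have h3 := finrank_span_singleton (K := K) (hz a₀)
    rw [Set.toFinset_singleton, Finset.card_singleton] at h1 h2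
    rw [Finset.coe_singleton, Set.image_singleton, Set.image_singleton, Set.image_singleton]
    omega
  obtain ⟨T, ⟨hTne, hT⟩, hmax⟩ := (wellFounded_gt (α := Finset ι)).has_min
    {T : Finset ι | T.Nonempty ∧ finrank K (span K (x '' T)) + finrank K (span K (y '' T)) ≤
      finrank K (span K (z '' T)) + 1}
    ⟨{a₀}, Finset.singleton_nonempty _, hsingle⟩
  by_cases hT' : ∃ a, a ∉ T
  · obtain ⟨T', hTT', hT'⟩ := exists_finset_enlarge ev hev hinj hns T hTne hT' hT
    exact absurd hTT' (hmax T' ⟨hTne.mono hTT'.1, hT'⟩)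
  · push Not at hT'
    rw [Finset.eq_univ_iff_forall.2 hT'] at hT
    rwa [Finset.coe_univ, Set.image_univ, Set.image_univ, Set.image_univ] at hT

end TwoFactors

section ManyFactors

/-- The product of the values of `x 0, …, x (d - 1)` under linear functionals: a faithful model of
the tensor `x 0 ⊗ ⋯ ⊗ x (d - 1)`. -/
def dualProd (K : Type*) [Field K] {d : ℕ} {V : Fin d → Type*} [∀ k, AddCommGroup (V k)]
    [∀ k, Module K (V k)] (x : ∀ k, V k) (g : ∀ k, Dual K (V k)) : K :=
  ∏ k, g k (x k)

theorem dualProd_ne_zero {d : ℕ} {V : Fin d → Type*} [∀ k, AddCommGroup (V k)]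
    [∀ k, Module K (V k)] {x : ∀ k, V k} (hx : ∀ k, x k ≠ 0) : dualProd K x ≠ 0 := by
  choose g hg using fun k => Module.Projective.exists_dual_eq_one K (hx k)
  intro h
  have := congrFun h g
  simp [dualProd, hg] at this

/-- Lower bound for the dimension spanned by a nonsplit family of product tensors. -/
theorem Nonsplit.sum_finrank_le {ι : Type*} [Fintype ι] [Nonempty ι] {d : ℕ} {V : Fin d → Type*}
    [∀ k, AddCommGroup (V k)] [∀ k, Module K (V k)] (x : ∀ k, ι → V k) (hx : ∀ k a, x k a ≠ 0)
    (hns : Nonsplit K fun a => dualProd K fun k => x k a) :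
    ∑ k, finrank K (span K (Set.range (x k))) + 1 ≤
      finrank K (span K (Set.range fun a => dualProd K fun k => x k a)) + d := by
  induction d with
  | zero =>
    have : FiniteDimensional K (span K (Set.range fun a => dualProd K fun k => x k a)) :=
      FiniteDimensional.span_of_finite K (Set.finite_range _)
    obtain ⟨a⟩ := ‹Nonempty ι›
    have h : 0 < finrank K (span K (Set.range fun a => dualProd K fun k => x k a)) := by
      rw [Module.finrank_pos_iff_exists_ne_zero]
      exact ⟨⟨_, Submodule.subset_span ⟨a, rfl⟩⟩, fun h =>
        dualProd_ne_zero (K := K) (fun k => hx k a) (congrArg Subtype.val h)⟩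
    rw [Fin.sum_univ_zero]
    omega
  | succ d ih =>
    -- Contraction in slot `0`: the two-factor bound is applied to the first factor against the
    -- product of the others.
    let ev : Dual K (V 0) → ((∀ k, Dual K (V k)) → K) →ₗ[K] ((∀ k : Fin d, Dual K (V k.succ)) → K) :=
      fun f => LinearMap.funLeft K K fun g => Fin.cons f g
    have hev : ∀ f a, ev f (dualProd K fun k => x k a) =
        f (x 0 a) • dualProd K fun k => x (Fin.succ k) a := by
      intro f a
      ext g
      simp [ev, LinearMap.funLeft_apply, dualProd, Fin.prod_univ_succ]
    have hinj : ∀ t, (∀ f, ev f t = 0) → t = 0 := by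
      intro t ht
      ext g
      have := congrFun (ht (g 0)) (Fin.tail g)
      simpa [ev, LinearMap.funLeft_apply] using this
    -- Contracting a common vector of two spans yields a common vector of the contracted spans, so
    -- the tails are nonsplit too.
    have hns' : Nonsplit K fun a => dualProd K fun k => x (Fin.succ k) a := by
      intro S hS hS'
      obtain ⟨t, ht0, ht1, ht2⟩ := hns S hS hS'
      have h1 : ∃ f, ev f t ≠ 0 := by
        by_contra! h
        exact ht0 (hinj t h)
      obtain ⟨f, hf⟩ := h1
      have h2 : ∀ S : Set ι, span K ((fun a => dualProd K fun k => x k a) '' S) ≤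
          (span K ((fun a => dualProd K fun k => x (Fin.succ k) a) '' S)).comap (ev f) := by
        intro S
        rw [Submodule.span_le]
        rintro _ ⟨a, ha, rfl⟩
        simp only [SetLike.mem_coe, Submodule.mem_comap, hev]
        exact Submodule.smul_mem _ _ (Submodule.subset_span ⟨a, ha, rfl⟩)
      exact ⟨ev f t, hf, h2 _ ht1, h2 _ ht2⟩
    have h1 := ih (fun k => x k.succ) (fun k a => hx _ a) hns'
    have h2 := hns.finrank_add_finrank_le ev hev hinj
      (fun a => dualProd_ne_zero (K := K) fun k => hx k a)
    rw [Fin.sum_univ_succ]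
    omega

end ManyFactors

end LinearAlgebra

/-! ### Kruskal's theorem from minimal linear relations -/

section Kruskal

variable {K : Type*} [Field K]

/-- A partial sum over `S` is nonzero by minimality and equals minus the sum over the complement, so
it lies in both spans. -/
theorem nonsplit_of_minimal_sum_eq_zero {ι M : Type*} [AddCommGroup M] [Module K M]
    (w : ι → K) (z : ι → M) (E : Finset ι) (hE : ∑ a ∈ E, w a • z a = 0)
    (hmin : ∀ S, S ⊂ E → S.Nonempty → ∑ a ∈ S, w a • z a ≠ 0) :
    Nonsplit K fun a : E => z a := by
  classical
  intro S hS ⟨b, hb⟩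
  have hs1 : ∑ a ∈ S, w a • z a ≠ 0 := by
    have h := hmin (S.map (Function.Embedding.subtype _)) ?_ (by simpa using hS)
    · simpa using h
    · refine Finset.ssubset_iff_subset_ne.2 ⟨fun a ha => ?_, fun h => hb ?_⟩
      · simp only [Finset.mem_map, Function.Embedding.subtype_apply] at ha
        obtain ⟨a, -, rfl⟩ := ha
        exact a.2
      · have hbE : (b : ι) ∈ S.map (Function.Embedding.subtype _) := by
          rw [h]; exact b.2
        simp only [Finset.mem_map, Function.Embedding.subtype_apply] at hbE
        obtain ⟨a, ha, hab⟩ := hbE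
        rwa [← Subtype.ext hab]
  refine ⟨_, hs1, Submodule.sum_mem _ fun a ha =>
    Submodule.smul_mem _ _ (Submodule.subset_span ⟨a, ha, rfl⟩), ?_⟩
  have h2 : ∑ a ∈ S, w a • z a = -∑ a ∈ Sᶜ, w a • z a := by
    rw [eq_neg_iff_add_eq_zero, Finset.sum_add_sum_compl, ← hE]
    exact Finset.sum_coe_sort E fun a => w a • z a
  rw [h2]
  refine Submodule.neg_mem _ (Submodule.sum_mem _ fun a ha =>
    Submodule.smul_mem _ _ (Submodule.subset_span ⟨a, by simpa using ha, rfl⟩))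

theorem finrank_span_add_one_le_card {ι M : Type*} [AddCommGroup M] [Module K M]
    (w : ι → K) (z : ι → M) (E : Finset ι) (hE : ∑ a ∈ E, w a • z a = 0) {b : ι} (hb : b ∈ E)
    (hwb : w b ≠ 0) :
    finrank K (span K (Set.range fun a : E => z a)) + 1 ≤ E.card := by
  have h1 := finrank_range_le_card (R := K) fun a : E => z a
  rw [Fintype.card_coe] at h1
  refine lt_of_le_of_ne h1 fun h => hwb ?_
  have h3 : LinearIndependent K fun a : E => z a := by
    rw [linearIndependent_iff_card_eq_finrank_span, Fintype.card_coe]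
    exact h.symm
  exact Fintype.linearIndependent_iff.1 h3 (fun a => w a)
    (by rw [← hE]; exact Finset.sum_coe_sort E fun a => w a • z a) ⟨b, hb⟩

/-- The numerical core of Kruskal's condition, for subfamilies. -/
theorem two_mul_add_le_sum_min {d r s : ℕ} (κ : Fin d → ℕ) (h1 : ∀ k, 1 ≤ κ k)
    (hr : ∀ k, κ k ≤ r) (hsum : 2 * r + d ≤ ∑ k, κ k + 1) (hs : 2 ≤ s) (hsr : s ≤ r) :
    2 * s + d ≤ ∑ k, min (κ k) s + 1 := by
  classical
  -- If at most two `κ k` exceed `s`, truncation costs at most $2(r-s)$. If at least three do, they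
  -- contribute `s` each and the others at least one, and $d+3(s-1)\ge 2s+d-1$ because $s\ge 2$.
  let J := Finset.univ.filter fun k => s < κ k
  by_cases hJ : J.card ≤ 2
  · have h : ∑ k, κ k ≤ ∑ k, min (κ k) s + J.card * (r - s) := by
      rw [← smul_eq_mul, ← Finset.sum_const, Finset.sum_filter, ← Finset.sum_add_distrib]
      refine Finset.sum_le_sum fun k _ => ?_
      have := hr k
      split_ifs <;> omega
    have h' : J.card * (r - s) ≤ 2 * (r - s) := Nat.mul_le_mul_right _ hJ
    omega
  · have h : d + J.card * (s - 1) ≤ ∑ k, min (κ k) s := by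
      have hd : ∑ _k : Fin d, 1 = d := by simp
      refine le_of_eq_of_le (congrArg (· + J.card * (s - 1)) hd.symm) ?_
      rw [← smul_eq_mul, ← Finset.sum_const, Finset.sum_filter, ← Finset.sum_add_distrib]
      refine Finset.sum_le_sum fun k _ => ?_
      have := h1 k
      split_ifs <;> omega
    have h' : 3 * (s - 1) ≤ J.card * (s - 1) := Nat.mul_le_mul_right _ (by omega)
    omega

variable {d : ℕ} {V : Fin d → Type*} [∀ k, AddCommGroup (V k)] [∀ k, Module K (V k)]

/-- The splitting bound from below meets the bound $|E|-1$ from above that the relation itself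
imposes. -/
theorem sum_finrank_add_two_le_card {ι : Type*} (w : ι → K) (x : ∀ k, ι → V k) (E : Finset ι)
    (hw : ∀ a ∈ E, w a ≠ 0) (hx : ∀ a ∈ E, ∀ k, x k a ≠ 0) (hne : E.Nonempty)
    (hE : ∑ a ∈ E, w a • dualProd K (fun k => x k a) = 0)
    (hmin : ∀ S, S ⊂ E → S.Nonempty → ∑ a ∈ S, w a • dualProd K (fun k => x k a) ≠ 0) :
    ∑ k, finrank K (span K (Set.range fun a : E => x k a)) + 2 ≤ E.card + d := by
  obtain ⟨b, hb⟩ := hne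
  have : Nonempty E := ⟨⟨b, hb⟩⟩
  have h0 : Nonsplit K fun a : E => dualProd K fun k => x k a :=
    nonsplit_of_minimal_sum_eq_zero w (fun a => dualProd K fun k => x k a) E hE hmin
  have h1 := Nonsplit.sum_finrank_le (fun k (a : E) => x k a) (fun k a => hx a a.2 k) h0
  have h2 := finrank_span_add_one_le_card w (fun a => dualProd K fun k => x k a) E hE hb (hw b hb)
  omega

variable {α β : Type*} [Fintype α] [Fintype β] {φ : ∀ k, α → V k} {ψ : ∀ k, β → V k}
  {κ : Fin d → ℕ}

/-- With $s\ge2$ terms on the left, each factor spans at least $\min(\kappa_k,s)$ dimensions, which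
forces $|E|\ge 2s+1$. For $s\le1$ only a one-to-one pair can fail the strict inequality, since a
single nonzero term cannot vanish. -/
theorem toLeft_lt_toRight_or_pair (h1 : ∀ k, 1 ≤ κ k) (hr : ∀ k, κ k ≤ Fintype.card α)
    (hsum : 2 * Fintype.card α + d ≤ ∑ k, κ k + 1)
    (hind : ∀ k (S : Finset α), S.card ≤ κ k → LinearIndepOn K (φ k) (S : Set α))
    (w : α ⊕ β → K) (E : Finset (α ⊕ β))
    (hw : ∀ a ∈ E, w a ≠ 0) (hx : ∀ a ∈ E, ∀ k, Sum.elim (φ k) (ψ k) a ≠ 0) (hne : E.Nonempty)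
    (hE : ∑ a ∈ E, w a • dualProd K (fun k => Sum.elim (φ k) (ψ k) a) = 0)
    (hmin : ∀ S, S ⊂ E → S.Nonempty →
      ∑ a ∈ S, w a • dualProd K (fun k => Sum.elim (φ k) (ψ k) a) ≠ 0) :
    E.toLeft.card < E.toRight.card ∨ ∃ p q, E.toLeft = {p} ∧ E.toRight = {q} := by
  by_cases hlt : E.toLeft.card < E.toRight.card
  · exact Or.inl hlt
  right
  have hcard := E.card_toLeft_add_card_toRight
  have hEpos : 0 < E.card := hne.card_pos
  have hle := sum_finrank_add_two_le_card w (fun k => Sum.elim (φ k) (ψ k)) E hw hx hne hE hmin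
  have hs : E.toLeft.card ≤ 1 := by
    by_contra! hs
    have hmain := two_mul_add_le_sum_min κ h1 hr hsum hs (Finset.card_le_univ _)
    have hfin : ∑ k, min (κ k) E.toLeft.card ≤
        ∑ k, finrank K (span K (Set.range fun a : E => Sum.elim (φ k) (ψ k) (a : α ⊕ β))) := by
      refine Finset.sum_le_sum fun k _ => ?_
      obtain ⟨S, hS, hScard⟩ := Finset.exists_subset_card_eq (min_le_right (κ k) E.toLeft.card)
      have hi := hind k S (hScard ▸ min_le_left _ _)
      have hd := finrank_span_eq_card hi
      simp only [Finset.coe_sort_coe, Fintype.card_coe] at hd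
      rw [← hScard, ← hd]
      have : FiniteDimensional K
          (span K (Set.range fun a : E => Sum.elim (φ k) (ψ k) (a : α ⊕ β))) :=
        FiniteDimensional.span_of_finite K (Set.finite_range _)
      refine Submodule.finrank_mono (Submodule.span_mono ?_)
      rintro _ ⟨⟨a, ha⟩, rfl⟩
      exact ⟨⟨Sum.inl a, Finset.mem_toLeft.1 (hS ha)⟩, rfl⟩
    omega
  have hone : ∃ p, E.toLeft = {p} := Finset.card_eq_one.1 (by omega)
  by_cases hR : E.toRight.card = 1
  · exact ⟨_, _, hone.choose_spec, (Finset.card_eq_one.1 hR).choose_spec⟩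
  · obtain ⟨a, rfl⟩ := Finset.card_eq_one.1 (show E.card = 1 by omega)
    have ha := Finset.mem_singleton_self a
    rw [Finset.sum_singleton] at hE
    exact absurd hE (smul_ne_zero (hw a ha) (dualProd_ne_zero (hx a ha)))

/-- Peeling off minimal vanishing subfamilies one at a time, no piece has more left than right
terms; equality overall forces every piece to be a pair. -/
theorem toLeft_le_toRight_and_matching (h1 : ∀ k, 1 ≤ κ k) (hr : ∀ k, κ k ≤ Fintype.card α)
    (hsum : 2 * Fintype.card α + d ≤ ∑ k, κ k + 1)
    (hind : ∀ k (S : Finset α), S.card ≤ κ k → LinearIndepOn K (φ k) (S : Set α))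
    (w : α ⊕ β → K) (E : Finset (α ⊕ β))
    (hw : ∀ a ∈ E, w a ≠ 0) (hx : ∀ a ∈ E, ∀ k, Sum.elim (φ k) (ψ k) a ≠ 0)
    (hE : ∑ a ∈ E, w a • dualProd K (fun k => Sum.elim (φ k) (ψ k) a) = 0) :
    E.toLeft.card ≤ E.toRight.card ∧ (E.toLeft.card = E.toRight.card →
      ∀ p ∈ E.toLeft, ∃ q ∈ E.toRight, w (Sum.inl p) • dualProd K (fun k => φ k p) +
        w (Sum.inr q) • dualProd K (fun k => ψ k q) = 0) := by
  classical
  induction E using Finset.strongInduction with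
  | H E ih =>
  rcases E.eq_empty_or_nonempty with rfl | hne
  · have hL : (∅ : Finset (α ⊕ β)).toLeft = ∅ := by ext; simp
    simp [hL]
  obtain ⟨F, ⟨hFE, hFne, hF⟩, hFmin⟩ := (wellFounded_lt (α := Finset (α ⊕ β))).has_min
    {F | F ⊆ E ∧ F.Nonempty ∧
      ∑ a ∈ F, w a • dualProd K (fun k => Sum.elim (φ k) (ψ k) a) = 0}
    ⟨E, subset_rfl, hne, hE⟩
  have hpair := toLeft_lt_toRight_or_pair h1 hr hsum hind w F (fun a ha => hw a (hFE ha))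
    (fun a ha => hx a (hFE ha)) hFne hF
    (fun S hS hSne hS0 => hFmin S ⟨hS.1.trans hFE, hSne, hS0⟩ hS)
  have hrest := ih (E \ F) (Finset.sdiff_ssubset hFE hFne)
    (fun a ha => hw a (Finset.sdiff_subset ha)) (fun a ha => hx a (Finset.sdiff_subset ha)) (by
      have := Finset.sum_sdiff (f := fun a => w a •
        dualProd K (fun k => Sum.elim (φ k) (ψ k) a)) hFE
      rwa [hF, hE, add_zero] at this)
  have hL : (E \ F).toLeft.card + F.toLeft.card = E.toLeft.card := by
    rw [Finset.toLeft_sdiff]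
    exact Finset.card_sdiff_add_card_eq_card (Finset.toLeft_subset_toLeft hFE)
  have hR : (E \ F).toRight.card + F.toRight.card = E.toRight.card := by
    rw [Finset.toRight_sdiff]
    exact Finset.card_sdiff_add_card_eq_card (Finset.toRight_subset_toRight hFE)
  obtain ⟨hrest1, hrest2⟩ := hrest
  rcases hpair with hlt | ⟨p, q, hp, hq⟩
  · exact ⟨by omega, fun h => by omega⟩
  · rw [hp, Finset.card_singleton] at hL
    rw [hq, Finset.card_singleton] at hR
    refine ⟨by omega, fun h p' hp' => ?_⟩
    by_cases hpp : p' = p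
    · subst hpp
      have hFeq : F = {Sum.inl p', Sum.inr q} := by
        ext a
        rcases a with a | a
        · rw [← Finset.mem_toLeft, hp]; simp
        · rw [← Finset.mem_toRight, hq]; simp
      refine ⟨q, Finset.mem_toRight.2 (hFE (by simp [hFeq])), ?_⟩
      rw [hFeq, Finset.sum_pair (by simp)] at hF
      exact hF
    · obtain ⟨q', hq', h'⟩ := hrest2 (by omega) p' (by
        rw [Finset.toLeft_sdiff, hp]
        simpa [hpp] using hp')
      exact ⟨q', Finset.toRight_subset_toRight Finset.sdiff_subset hq', h'⟩

/-- **Kruskal's theorem** for tensors of arbitrary order. -/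
theorem kruskal (h1 : ∀ k, 1 ≤ κ k) (hr : ∀ k, κ k ≤ Fintype.card α)
    (hsum : 2 * Fintype.card α + d ≤ ∑ k, κ k + 1)
    (hind : ∀ k (S : Finset α), S.card ≤ κ k → LinearIndepOn K (φ k) (S : Set α))
    (l : α → K) (m : β → K) (hl : ∀ p, l p ≠ 0) (hφ : ∀ k p, φ k p ≠ 0)
    (heq : ∑ p, l p • dualProd K (fun k => φ k p) = ∑ q, m q • dualProd K (fun k => ψ k q)) :
    Fintype.card α ≤ Fintype.card β ∧ (Fintype.card α = Fintype.card β → ∃ e : α ≃ β,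
      ∀ p, l p • dualProd K (fun k => φ k p) = m (e p) • dualProd K (fun k => ψ k (e p))) := by
  classical
  let w : α ⊕ β → K := Sum.elim l fun q => -m q
  -- The second decomposition may contain zero terms; they are discarded. No term of the first is
  -- lost.
  let E : Finset (α ⊕ β) :=
    Finset.univ.filter fun a => w a ≠ 0 ∧ ∀ k, Sum.elim (φ k) (ψ k) a ≠ 0
  have hEL : E.toLeft = Finset.univ := by
    ext p
    simp [E, w, hl, hφ]
  have hER : E.toRight.card ≤ Fintype.card β := Finset.card_le_univ _
  have hE : ∑ a ∈ E, w a • dualProd K (fun k => Sum.elim (φ k) (ψ k) a) = 0 := by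
    rw [Finset.sum_filter_of_ne, Fintype.sum_sum_type]
    · simp [w, heq]
    · intro a _ ha
      rw [smul_ne_zero_iff] at ha
      refine ⟨ha.1, fun k hk => ha.2 ?_⟩
      ext g
      exact Finset.prod_eq_zero (Finset.mem_univ k) (by simp only [hk, map_zero])
  have hmain := toLeft_le_toRight_and_matching h1 hr hsum hind w E
    (fun a ha => (Finset.mem_filter.1 ha).2.1) (fun a ha => (Finset.mem_filter.1 ha).2.2) hE
  rw [hEL, Finset.card_univ] at hmain
  refine ⟨hmain.1.trans hER, fun hcard => ?_⟩
  have hmatch := hmain.2 (le_antisymm hmain.1 (hcard ▸ hER))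
  choose f hf using fun p => hmatch p (Finset.mem_univ p)
  have hfeq : ∀ p, l p • dualProd K (fun k => φ k p) = m (f p) • dualProd K (fun k => ψ k (f p)) := by
    intro p
    have := (hf p).2
    simp only [w, Sum.elim_inl, Sum.elim_inr, neg_smul] at this
    exact add_neg_eq_zero.1 this
  have hinj : Function.Injective f := by
    intro p p' hpp
    by_contra hne
    -- Two left terms with the same partner are equal, which gives a relation with two left terms
    -- and no right ones, contradicting the count.
    let w' : α ⊕ β → K := Sum.elim (fun a => if a = p then l p else -l a) fun _ => 0
    have hbad := toLeft_le_toRight_and_matching (ψ := ψ) h1 hr hsum hind w'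
      {Sum.inl p, Sum.inl p'} (by simp [w', hl, Ne.symm hne]) (by simp [hφ]) (by
        rw [Finset.sum_pair (by simpa using hne)]
        have h2 : l p • dualProd K (fun k => φ k p) = l p' • dualProd K (fun k => φ k p') := by
          rw [hfeq p, hfeq p', hpp]
        simp [w', Ne.symm hne, h2])
    have hL : ({Sum.inl p, Sum.inl p'} : Finset (α ⊕ β)).toLeft = {p, p'} := by ext; simp
    have hR : ({Sum.inl p, Sum.inl p'} : Finset (α ⊕ β)).toRight = ∅ := by ext; simp
    rw [hL, hR, Finset.card_pair hne] at hbad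
    simp at hbad
  exact ⟨Equiv.ofBijective f ((Fintype.bijective_iff_injective_and_card f).2 ⟨hinj, hcard⟩), hfeq⟩

end Kruskal

/-! ### From coherence to Kruskal rank -/

section Coherence

variable {ι H : Type*} [NormedAddCommGroup H] [InnerProductSpace ℂ H]

theorem enorm_inner_le_coherence (φ : ι → H) {p q : ι} (hpq : p ≠ q) :
    ‖inner ℂ (φ p) (φ q)‖ₑ ≤ coherence φ :=
  le_iSup_of_le p (le_iSup_of_le q (le_iSup_of_le hpq le_rfl))

theorem coherence_le_one {φ : ι → H} (hφ : ∀ p, ‖φ p‖ = 1) : coherence φ ≤ 1 := by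
  refine iSup_le fun p => iSup_le fun q => iSup_le fun _ => ?_
  have h := norm_inner_le_norm (𝕜 := ℂ) (φ p) (φ q)
  rw [hφ, hφ, mul_one] at h
  rw [← ofReal_norm]
  exact ENNReal.ofReal_le_one.2 h

variable [Fintype ι]

/-- A family of `n + 1` unit vectors with `n * coherence < 1` is linearly independent. -/
theorem linearIndependent_of_mul_coherence_lt_one {φ : ι → H} (hφ : ∀ p, ‖φ p‖ = 1)
    {n : ℕ} (hn : (n : ℝ≥0∞) * coherence φ < 1) (S : Finset ι) (hS : S.card = n + 1) :
    LinearIndependent ℂ (fun i : S => φ i) := by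
  classical
  rw [Fintype.linearIndependent_iff]
  intro c hc
  have : Nonempty S := (Finset.card_pos.1 (by omega : 0 < S.card)).to_subtype
  -- Pairing the relation with the vector of largest coefficient bounds that coefficient by `n *
  -- coherence φ` times itself.
  obtain ⟨i, hi⟩ := Finite.exists_max fun i => ‖c i‖ₑ
  suffices hci : c i = 0 by
    intro j
    have := hi j
    rw [hci, enorm_zero, nonpos_iff_eq_zero, enorm_eq_zero] at this
    exact this
  by_contra hci
  have h1 : inner ℂ (φ i) (∑ j, c j • φ j) = 0 := by rw [hc, inner_zero_right]
  rw [inner_sum, ← Finset.add_sum_erase _ _ (Finset.mem_univ i)] at h1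
  simp only [inner_smul_right] at h1
  rw [inner_self_eq_norm_sq_to_K, hφ] at h1
  have h2 : c i = -∑ j ∈ Finset.univ.erase i, c j * inner ℂ (φ i) (φ j) := by
    rw [eq_neg_iff_add_eq_zero]
    simpa using h1
  have h3 : ‖c i‖ₑ ≤ ∑ j ∈ Finset.univ.erase i, ‖c i‖ₑ * coherence φ := by
    conv_lhs => rw [h2, enorm_neg]
    refine (enorm_sum_le _ _).trans (Finset.sum_le_sum fun j hj => ?_)
    rw [enorm_mul]
    refine mul_le_mul' (hi j) (enorm_inner_le_coherence φ fun h => ?_)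
    exact (Finset.mem_erase.1 hj).1 (Subtype.ext h.symm)
  rw [Finset.sum_const, Finset.card_erase_of_mem (Finset.mem_univ i), Finset.card_univ,
    Fintype.card_coe, hS, Nat.add_sub_cancel, nsmul_eq_mul, mul_left_comm] at h3
  have h4 : ‖c i‖ₑ * (n * coherence φ) < ‖c i‖ₑ * 1 :=
    ENNReal.mul_lt_mul_right (by simpa using hci) enorm_ne_top hn
  rw [mul_one] at h4
  exact absurd h3 h4.not_ge

theorem krank_mem (φ : ι → H) : krank φ ≤ Fintype.card ι ∧
    ∀ S : Finset ι, S.card = krank φ → LinearIndependent ℂ (fun i : S => φ i) := by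
  refine Nat.sSup_mem (s := {k : ℕ | k ≤ Fintype.card ι ∧
    ∀ S : Finset ι, S.card = k → LinearIndependent ℂ (fun i : S => φ i)}) ⟨0, Nat.zero_le _, ?_⟩
    ⟨Fintype.card ι, fun k hk => hk.1⟩
  intro S hS
  rw [Finset.card_eq_zero] at hS
  subst hS
  exact linearIndependent_empty_type

theorem le_krank {φ : ι → H} {k : ℕ} (hk : k ≤ Fintype.card ι)
    (h : ∀ S : Finset ι, S.card = k → LinearIndependent ℂ (fun i : S => φ i)) : k ≤ krank φ :=
  le_csSup ⟨Fintype.card ι, fun _ hk => hk.1⟩ ⟨hk, h⟩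

theorem linearIndepOn_of_card_le_krank (φ : ι → H) (S : Finset ι) (hS : S.card ≤ krank φ) :
    LinearIndepOn ℂ φ (S : Set ι) := by
  obtain ⟨T, hST, hT⟩ := Finset.exists_superset_card_eq hS (krank_mem φ).1
  have h : LinearIndepOn ℂ φ (T : Set ι) := (krank_mem φ).2 T hT
  exact h.mono (by simpa using hST)

theorem dimSpan_le_card (φ : ι → H) : dimSpan φ ≤ Fintype.card ι :=
  finrank_range_le_card φ

/-- Otherwise any `krank φ + 1` members would be independent; `h` ensures that there are that many
members. -/
theorem one_le_krank_mul_coherence {φ : ι → H} (hφ : ∀ p, ‖φ p‖ = 1)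
    (h : krank φ < dimSpan φ) : 1 ≤ (krank φ : ℝ≥0∞) * coherence φ := by
  by_contra! hlt
  have := le_krank (Nat.succ_le_of_lt (h.trans_le (dimSpan_le_card φ)))
    (linearIndependent_of_mul_coherence_lt_one hφ hlt)
  omega

theorem one_div_coherence_le_krank {φ : ι → H} (hφ : ∀ p, ‖φ p‖ = 1)
    (h : krank φ < dimSpan φ) : 1 / coherence φ ≤ krank φ :=
  ENNReal.div_le_of_le_mul (one_le_krank_mul_coherence hφ h)

theorem one_le_krank {φ : ι → H} (hφ : ∀ p, ‖φ p‖ = 1) (h : krank φ < dimSpan φ) :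
    1 ≤ krank φ := by
  have h1 := one_le_krank_mul_coherence hφ h
  by_contra! h0
  rw [Nat.lt_one_iff] at h0
  simp [h0] at h1

theorem relIncoherence_add_one {φ : ι → H} (hφ : ∀ p, ‖φ p‖ = 1) (h : krank φ < dimSpan φ) :
    relIncoherence φ + 1 = 1 / coherence φ := by
  have h1 := one_le_krank_mul_coherence hφ h
  have hle := coherence_le_one hφ
  have h0 : coherence φ ≠ 0 := by
    intro h0
    simp [h0] at h1
  have htop : coherence φ ≠ ⊤ := ne_top_of_le_ne_top ENNReal.one_ne_top hle
  rw [relIncoherence, ← ENNReal.div_self h0 htop, ENNReal.div_add_div_same,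
    tsub_add_cancel_of_le (by rwa [ENNReal.div_self h0 htop])]

end Coherence

/-! ### From almost everywhere identities to identities of tensors -/

section Pairing

/-- An algebraic functional may be discontinuous, but on a finite-dimensional span the Riesz
representation applies. -/
theorem exists_inner_eq_dual {H : Type*} [NormedAddCommGroup H] [InnerProductSpace ℂ H]
    (g : Dual ℂ H) {s : Set H} (hs : s.Finite) : ∃ h : H, ∀ v ∈ s, inner ℂ h v = g v := by
  let U := span ℂ s
  have : FiniteDimensional ℂ U := FiniteDimensional.span_of_finite ℂ hs
  have : CompleteSpace U := FiniteDimensional.complete ℂ U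
  refine ⟨(InnerProductSpace.toDual ℂ U).symm (LinearMap.toContinuousLinearMap (g ∘ₗ U.subtype)),
    fun v hv => ?_⟩
  have := InnerProductSpace.toDual_symm_apply (𝕜 := ℂ) (x := (⟨v, subset_span hv⟩ : U))
    (y := LinearMap.toContinuousLinearMap (g ∘ₗ U.subtype))
  rw [Submodule.coe_inner] at this
  rw [this]
  rfl

variable {d : ℕ} {X : Fin d → Type*} [∀ k, MeasurableSpace (X k)] {μ : ∀ k, Measure (X k)}

theorem prod_inner_apply (h φ : ∀ k, Lp ℂ 2 (μ k)) (x : ∀ k, X k) :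
    ∏ k, inner ℂ (h k (x k)) (φ k (x k)) =
      (∏ k, (starRingEnd ℂ) (h k (x k))) * tensorFun φ x := by
  rw [tensorFun, ← Finset.prod_mul_distrib]
  exact Finset.prod_congr rfl fun k _ => by rw [RCLike.inner_apply, mul_comm]

variable [∀ k, SigmaFinite (μ k)]

theorem integrable_prod_inner (h φ : ∀ k, Lp ℂ 2 (μ k)) :
    Integrable (fun x => ∏ k, inner ℂ (h k (x k)) (φ k (x k))) (Measure.pi μ) :=
  Integrable.fintype_prod_dep (f := fun k y => inner ℂ (h k y) (φ k y))
    fun k => L2.integrable_inner (h k) (φ k)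

theorem integral_prod_inner (h φ : ∀ k, Lp ℂ 2 (μ k)) :
    ∫ x, ∏ k, inner ℂ (h k (x k)) (φ k (x k)) ∂Measure.pi μ = ∏ k, inner ℂ (h k) (φ k) := by
  rw [integral_fintype_prod_eq_prod (fun k y => inner ℂ (h k y) (φ k y))]
  simp_rw [L2.inner_def]

theorem integral_mul_sum_tensorFun {α : Type*} [Fintype α] (l : α → ℂ)
    (φ : ∀ k, α → Lp ℂ 2 (μ k)) (h : ∀ k, Lp ℂ 2 (μ k)) :
    ∫ x, (∏ k, (starRingEnd ℂ) (h k (x k))) * ∑ p, l p * tensorFun (fun k => φ k p) x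
      ∂Measure.pi μ = ∑ p, l p * ∏ k, inner ℂ (h k) (φ k p) := by
  have h1 : ∀ x, (∏ k, (starRingEnd ℂ) (h k (x k))) * ∑ p, l p * tensorFun (fun k => φ k p) x =
      ∑ p, l p * ∏ k, inner ℂ (h k (x k)) (φ k p (x k)) := by
    intro x
    rw [Finset.mul_sum]
    refine Finset.sum_congr rfl fun p _ => ?_
    rw [prod_inner_apply h (fun k => φ k p), mul_left_comm]
  simp_rw [h1]
  rw [integral_finsetSum _ fun p _ => (integrable_prod_inner h fun k => φ k p).const_mul _]
  refine Finset.sum_congr rfl fun p _ => ?_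
  rw [integral_const_mul, integral_prod_inner h fun k => φ k p]

/-- Functionals are represented by inner products on the finitely many factors involved; integrating
against the conjugate product then evaluates both sides by Fubini. -/
theorem sum_dualProd_eq_of_ae_eq {α β : Type*} [Fintype α] [Fintype β] {l : α → ℂ} {m : β → ℂ}
    {φ : ∀ k, α → Lp ℂ 2 (μ k)} {ψ : ∀ k, β → Lp ℂ 2 (μ k)}
    (h : (fun x => ∑ p, l p * tensorFun (fun k => φ k p) x) =ᵐ[Measure.pi μ]
      fun x => ∑ q, m q * tensorFun (fun k => ψ k q) x) :
    ∑ p, l p • dualProd ℂ (fun k => φ k p) = ∑ q, m q • dualProd ℂ (fun k => ψ k q) := by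
  ext g
  choose v hv using fun k => exists_inner_eq_dual (g k)
    ((Set.finite_range (φ k)).union (Set.finite_range (ψ k)))
  have h1 := integral_congr_ae (μ := Measure.pi μ) (h.mono fun x hx =>
    congrArg (fun t => (∏ k, (starRingEnd ℂ) (v k (x k))) * t) hx)
  simp only [integral_mul_sum_tensorFun] at h1
  simp only [Finset.sum_apply, Pi.smul_apply, smul_eq_mul, dualProd]
  have hl : ∀ k p, inner ℂ (v k) (φ k p) = g k (φ k p) := fun k p => hv k _ (Or.inl ⟨p, rfl⟩)
  have hr : ∀ k q, inner ℂ (v k) (ψ k q) = g k (ψ k q) := fun k q => hv k _ (Or.inr ⟨q, rfl⟩)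
  simpa only [hl, hr] using h1

end Pairing

theorem exists_phases_of_smul_dualProd_eq {d : ℕ} {H : Fin d → Type*}
    [∀ k, NormedAddCommGroup (H k)] [∀ k, NormedSpace ℂ (H k)] {u v : ∀ k, H k} {l m : ℂ}
    (hl : l ≠ 0) (hu : ∀ k, ‖u k‖ = 1) (hv : ∀ k, ‖v k‖ = 1)
    (h : l • dualProd ℂ u = m • dualProd ℂ v) :
    ∃ c : Fin d → ℂ, (∀ k, ‖c k‖ = 1) ∧ (∀ k, u k = c k • v k) ∧ m = l * ∏ k, c k := by
  classical
  have hne : ∀ {k} {w : ∀ k, H k}, (∀ k, ‖w k‖ = 1) → w k ≠ 0 := by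
    intro k w hw h0
    simpa [h0] using hw k
  choose g hg using fun k => Module.Projective.exists_dual_eq_one ℂ (hne hu : u k ≠ 0)
  have hparallel : ∀ k, ∃ c : ℂ, u k = c • v k := by
    intro k
    refine ⟨l⁻¹ * (m * ∏ j ∈ Finset.univ.erase k, g j (v j)), ?_⟩
    rw [← sub_eq_zero, ← Module.forall_dual_apply_eq_zero_iff ℂ]
    -- Only the functional in slot `k` varies; the others are fixed to take the value `1` on `u`.
    intro f
    have hf := congrFun h (Function.update g k f)
    have herase : ∀ w : ∀ k, H k, ∏ j, Function.update g k f j (w j) =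
        f (w k) * ∏ j ∈ Finset.univ.erase k, g j (w j) := by
      intro w
      rw [← Finset.mul_prod_erase _ _ (Finset.mem_univ k), Function.update_self]
      congr 1
      exact Finset.prod_congr rfl fun j hj => by
        rw [Function.update_of_ne (Finset.mem_erase.1 hj).1]
    simp only [Pi.smul_apply, smul_eq_mul, dualProd, herase, hg, Finset.prod_const_one,
      mul_one] at hf
    rw [map_sub, map_smul, smul_eq_mul, sub_eq_zero]
    field_simp
    linear_combination hf
  choose c hc using hparallel
  refine ⟨c, fun k => ?_, hc, ?_⟩
  · have := hu k
    rwa [hc, norm_smul, hv, mul_one] at this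
  · choose g' hg' using fun k => Module.Projective.exists_dual_eq_one ℂ (hne hv : v k ≠ 0)
    have := congrFun h g'
    simp only [Pi.smul_apply, smul_eq_mul, dualProd, hc, map_smul, hg', mul_one,
      Finset.prod_const_one] at this
    exact this.symm

/-! ### Rank and uniqueness for decompositions in $L^2$ -/

section Decompositions

variable {d r : ℕ} {X : Fin d → Type*} [∀ k, MeasurableSpace (X k)] {μ : ∀ k, Measure (X k)}
  {f : Lp ℂ 2 (Measure.pi μ)} {lam : Fin r → ℂ}
  {φ : ∀ k, Fin r → Lp ℂ 2 (μ k)}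

theorem IsUnitDecomposition.ne_zero (hf : IsUnitDecomposition f lam φ) (k : Fin d) (p : Fin r) :
    φ k p ≠ 0 := by
  intro h
  have := hf.norm_eq_one k p
  simp [h] at this

theorem UniqueUpToOrderAndPhase.essentiallyUnique {σ : Fin r → ℝ}
    (h : UniqueUpToOrderAndPhase f (fun p => (σ p : ℂ)) φ) (hanti : Antitone σ)
    (hpos : ∀ p, 0 < σ p) : EssentiallyUnique f σ φ := by
  intro τ ψ hτ
  obtain ⟨e, c, hc1, hc2, hc3⟩ := h _ ψ hτ.decomposition
  have heq : ∀ p, τ (e p) = σ p := by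
    intro p
    have := congrArg norm (hc3 p)
    rw [norm_mul, norm_prod, Finset.prod_congr rfl fun k _ => hc1 k p, Finset.prod_const_one,
      mul_one, Complex.norm_of_nonneg (hτ.pos _).le, Complex.norm_of_nonneg (hpos _).le] at this
    exact this
  have hcomp : τ ∘ e = σ := funext heq
  -- Both `τ` and its rearrangement `τ ∘ e = σ` are antitone, and a sorted rearrangement is unique.
  have hστ : ∀ p, σ p = τ p := by
    have := Tuple.unique_monotone (f := OrderDual.toDual ∘ τ) (σ := e) (τ := Equiv.refl _)
      (by
        rw [Function.comp_assoc, hcomp]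
        exact hanti.dual_right)
      hτ.antitone.dual_right
    intro p
    rw [← heq p]
    exact congrFun this p
  refine ⟨hστ, e, fun p => by rw [hστ, heq], fun k p => (c k p).arg, fun k p => ?_, fun p => ?_⟩
  · have := Complex.norm_mul_exp_arg_mul_I (c k p)
    rw [hc1, Complex.ofReal_one, one_mul, mul_comm] at this
    rw [this]
    exact hc2 k p
  · have h1 : ∏ k, c k p = 1 := by
      have h2 := hc3 p
      rw [heq] at h2
      exact mul_left_cancel₀ (Complex.ofReal_ne_zero.2 (hpos p).ne') (by rw [← h2, mul_one])
    have h3 : Complex.exp ((∑ k, (c k p).arg : ℝ) * Complex.I) = 1 := by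
      rw [Complex.ofReal_sum, Finset.sum_mul, Complex.exp_sum, ← h1]
      refine Finset.prod_congr rfl fun k _ => ?_
      have := Complex.norm_mul_exp_arg_mul_I (c k p)
      rwa [hc1, Complex.ofReal_one, one_mul] at this
    obtain ⟨n, hn⟩ := Complex.exp_eq_one_iff.1 h3
    refine ⟨n, ?_⟩
    rw [← mul_assoc] at hn
    have h4 := mul_right_cancel₀ Complex.I_ne_zero hn
    have h5 : ((∑ k, (c k p).arg : ℝ) : ℂ) = ((2 * Real.pi * n : ℝ) : ℂ) := by
      rw [h4]
      push_cast
      ring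
    exact Complex.ofReal_injective h5

variable [∀ k, SigmaFinite (μ k)]

theorem tensorFun_smul_ae_eq (c : Fin r → ℂ) (φ : ∀ k, Fin r → Lp ℂ 2 (μ k)) :
    (fun x => ∑ p, tensorFun (fun k => c p • φ k p) x) =ᵐ[Measure.pi μ]
      fun x => ∑ p, c p ^ d * tensorFun (fun k => φ k p) x := by
  have h : ∀ᵐ x ∂Measure.pi μ, ∀ k p, (c p • φ k p : Lp ℂ 2 (μ k)) (x k) = c p * φ k p (x k) := by
    rw [ae_all_iff]
    intro k
    rw [ae_all_iff]
    intro p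
    exact (Measure.quasiMeasurePreserving_eval μ k).ae (Lp.coeFn_smul (c p) (φ k p))
  filter_upwards [h] with x hx
  refine Finset.sum_congr rfl fun p _ => ?_
  simp only [tensorFun, hx, Finset.prod_mul_distrib, Finset.prod_const, Finset.card_univ,
    Fintype.card_fin]

/-- The terms counted by `rank` carry no coefficients, so a `d`-th root of `lam p` is absorbed into
each factor; for `d = 0` there is no factor to absorb it. -/
theorem rank_le (hd : d ≠ 0 ∨ r = 0) (hf : IsUnitDecomposition f lam φ) : rank f ≤ r := by
  have hroot : ∀ p, ∃ c : ℂ, c ^ d = lam p := by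
    intro p
    rcases hd with hd | rfl
    · exact IsAlgClosed.exists_pow_nat_eq _ (Nat.pos_of_ne_zero hd)
    · exact p.elim0
  choose c hc using hroot
  refine iInf₂_le r ⟨fun k p => c p • φ k p, hf.ae_eq.trans ?_⟩
  refine Filter.EventuallyEq.trans ?_ (tensorFun_smul_ae_eq c φ).symm
  simp only [hc]
  rfl

/-- The competitor `ψ` is not normalized and may have another length, so that one statement serves
both the rank and uniqueness. -/
theorem IsUnitDecomposition.kruskal {r' : ℕ} {m : Fin r' → ℂ} {ψ : ∀ k, Fin r' → Lp ℂ 2 (μ k)}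
    (hf : IsUnitDecomposition f lam φ) (hlam : ∀ p, lam p ≠ 0) (hone : ∀ k, 1 ≤ krank (φ k))
    (hsum : 2 * r + d ≤ ∑ k, krank (φ k) + 1)
    (hm : f =ᵐ[Measure.pi μ] fun x => ∑ q, m q * tensorFun (fun k => ψ k q) x) :
    r ≤ r' ∧ (r = r' → ∃ e : Fin r ≃ Fin r', ∀ p, lam p • dualProd ℂ (fun k => φ k p) =
      m (e p) • dualProd ℂ (fun k => ψ k (e p))) := by
  have h := MultilinearDecomposition.kruskal (K := ℂ) (φ := φ) (ψ := ψ) (κ := fun k => krank (φ k)) hone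
    (fun k => (krank_mem (φ k)).1) (by simpa using hsum)
    (fun k => linearIndepOn_of_card_le_krank (φ k)) lam m hlam hf.ne_zero
    (sum_dualProd_eq_of_ae_eq (hf.ae_eq.symm.trans hm))
  simpa only [Fintype.card_fin] using h

theorem rank_eq (hf : IsUnitDecomposition f lam φ) (hlam : ∀ p, lam p ≠ 0)
    (hone : ∀ k, 1 ≤ krank (φ k)) (hsum : 2 * r + d ≤ ∑ k, krank (φ k) + 1) : rank f = r := by
  refine le_antisymm (rank_le ?_ hf) (le_iInf₂ fun r' ⟨ψ, hψ⟩ => ?_)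
  · by_cases hd : d = 0
    · subst hd
      rw [Fin.sum_univ_zero] at hsum
      omega
    · exact Or.inl hd
  · exact Nat.cast_le.2 (hf.kruskal (m := fun _ => 1) (ψ := ψ) hlam hone hsum
      (by simpa only [one_mul] using hψ)).1

theorem IsUnitDecomposition.uniqueUpToOrderAndPhase (hf : IsUnitDecomposition f lam φ)
    (hlam : ∀ p, lam p ≠ 0) (hone : ∀ k, 1 ≤ krank (φ k))
    (hsum : 2 * r + d ≤ ∑ k, krank (φ k) + 1) : UniqueUpToOrderAndPhase f lam φ := by
  intro m ψ hψ
  obtain ⟨e, he⟩ := (hf.kruskal hlam hone hsum hψ.ae_eq).2 rfl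
  choose c hc1 hc2 hc3 using fun p => exists_phases_of_smul_dualProd_eq (hlam p)
    (fun k => hf.norm_eq_one k p) (fun k => hψ.norm_eq_one k (e p)) (he p)
  exact ⟨e, fun k p => c p k, fun k p => hc1 p k, fun k p => hc2 p k, hc3⟩

end Decompositions

end MultilinearDecomposition

theorem mainTheorem2 {d r : ℕ} {X : Fin d → Type*} [∀ k, MeasurableSpace (X k)]
    (μ : ∀ k, Measure (X k)) [∀ k, SigmaFinite (μ k)]
    (f : Lp ℂ 2 (Measure.pi μ)) (lam : Fin r → ℂ) (φ : ∀ k, Fin r → Lp ℂ 2 (μ k))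
    (hlam : ∀ p, lam p ≠ 0)
    (hf : MultilinearDecomposition.IsUnitDecomposition f lam φ)
    (hkrank : ∀ k, MultilinearDecomposition.krank (φ k) < MultilinearDecomposition.dimSpan (φ k)) :
    ((2 * (r : ℝ≥0∞) - 1 ≤ ∑ k, MultilinearDecomposition.relIncoherence (φ k)) ↔
      (2 * (r : ℝ≥0∞) + d - 1 ≤ ∑ k, 1 / MultilinearDecomposition.coherence (φ k))) ∧
    (2 * (r : ℝ≥0∞) - 1 ≤ ∑ k, MultilinearDecomposition.relIncoherence (φ k) →
      MultilinearDecomposition.rank f = r ∧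
      MultilinearDecomposition.UniqueUpToOrderAndPhase f lam φ ∧
      ∀ σ : Fin r → ℝ, (∀ p, lam p = σ p) → Antitone σ → (∀ p, 0 < σ p) →
        MultilinearDecomposition.EssentiallyUnique f σ φ) := by
  have hequiv : (2 * (r : ℝ≥0∞) - 1 ≤ ∑ k, MultilinearDecomposition.relIncoherence (φ k)) ↔
      (2 * (r : ℝ≥0∞) + d - 1 ≤ ∑ k, 1 / MultilinearDecomposition.coherence (φ k)) := by
    -- Since $\omega_k+1=1/\mu_k$, the two conditions differ by adding the finite number `d` to both
    -- sides.
    have hsum : ∑ k, 1 / MultilinearDecomposition.coherence (φ k) =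
        ∑ k, MultilinearDecomposition.relIncoherence (φ k) + d := by
      simp_rw [← MultilinearDecomposition.relIncoherence_add_one (hf.norm_eq_one _) (hkrank _)]
      simp [Finset.sum_add_distrib]
    rw [hsum, tsub_le_iff_right, tsub_le_iff_right, add_right_comm,
      ENNReal.add_le_add_iff_right (ENNReal.natCast_ne_top d)]
  refine ⟨hequiv, fun h => ?_⟩
  have hone : ∀ k, 1 ≤ MultilinearDecomposition.krank (φ k) := fun k =>
    MultilinearDecomposition.one_le_krank (hf.norm_eq_one k) (hkrank k)
  have hsum : 2 * r + d ≤ ∑ k, MultilinearDecomposition.krank (φ k) + 1 := by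
    have h1 := (hequiv.1 h).trans (Finset.sum_le_sum fun k _ =>
      MultilinearDecomposition.one_div_coherence_le_krank (hf.norm_eq_one k) (hkrank k))
    rw [tsub_le_iff_right] at h1
    exact_mod_cast h1
  have hunique := hf.uniqueUpToOrderAndPhase hlam hone hsum
  refine ⟨MultilinearDecomposition.rank_eq hf hlam hone hsum, hunique, fun σ hσ hanti hpos => ?_⟩
  obtain rfl : lam = fun p => (σ p : ℂ) := funext hσ
  exact hunique.essentiallyUnique hanti hpos
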